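/- **Setting.** A piecewise-stationary Bernoulli combinatorial semi-bandit has $K$ base arms, a family $\mathcal F$ of feasible super arms (subsets of the arms) and a function $r_\mu(S)$ giving the expected reward of $S\in\mathcal F$ under the mean vector $\mu$. In each round $t=1,\dots,T$ the policy chooses, possibly at random, $S_t\in\mathcal F$ depending on its past choices and feedback; the outcomes of the arms are independent Bernoulli variables with means $\mu_t=(\mu_t(1),\dots,\mu_t(K))$, and the outcomes of the arms in $S_t$ are revealed. The expected regret is $\mathcal R(T)=\mathbb E\big[\sum_{t=1}^T(\max_{S\in\mathcal F}r_{\mu_t}(S)-r_{\mu_t}(S_t))\big]$, and the number of stationary segments is $1+\#\{1\le t<T:\mu_t\neq\mu_{t+1}\}$. The lower bounds below already hold for the special case in which $\mathcal F$ consists of all singletons and $r_\mu(S)=\sum_{k\in S}\mu(k)$ (the $K$-armed bandit). **Theorem (minimax lower bound).** Let $K\ge 3$, $N\ge 1$, $T\ge 0$ be integers, let $\mathcal F$ be the family of singletons with $r_\mu(S)=\sum_{k\in S}\mu(k)$, and let $\pi$ be any (randomized, history-dependent) policy. For $\epsilon>0$, $\epsilon\le\frac14$, consider the following randomized instance. The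 horizon is cut into $N$ consecutive segments, the first $N-1$ of length $\lceil T/N\rceil$ and the last consisting of the remaining rounds (segments are truncated at $T$; all have length $T/N$ if $N\mid T$). In each segment one optimal arm has mean $\frac12+\epsilon$ and all others have mean $\frac12$. The optimal arm of the first segment is uniform over all $K$ arms, and the optimal arm of each later segment is uniform over the $K-1$ arms other than the optimal arm of the preceding segment. 1. For every $0<\epsilon\le\frac14$, the expected regret of $\pi$ on this randomized instance (expectation also over the optimal arms) satisfies $$\mathcal R(T)\ \ge\ \frac{\epsilon T}{2}-\frac{\epsilon^2T}{K-1}\sqrt{\frac{KT}{N}\log\frac43}.$$ 2. If $T\ge \dfrac{N(K-1)^2}{K\log(4/3)}$, then with $\epsilon=\dfrac{K-1}{4}\sqrt{\dfrac{N}{TK\log(4/3)}}$ the expected regret of $\pi$ on the randomized instance is at least $\dfrac{1}{24\sqrt{\log(4/3)}}\sqrt{NKT}$. 3. Under the same condition on $T$, there is a deterministic choice of Bernoulli means $(\mu_t)_{t\le T}$ with exactly $N$ stationary segments on which the expected regret of $\pi$ is at least $\dfrac{1}{24\sqrt{\log(4/3)}}\sqrt{NKT}$. -/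

import Mathlib

open scoped ENNReal unitInterval

noncomputable section

namespace SemiBandit

/-- The joint law of the `0/1` outcomes of the `K` base arms in one round: independent Bernoulli
variables, arm `k` having mean `p k`. -/
def outcomeLaw {K : ℕ} (p : Fin K → I) : PMF (Fin K → Bool) :=
  PMF.ofFintype
    (fun x => ∏ k, if x k then ENNReal.ofReal (p k : ℝ) else ENNReal.ofReal (1 - (p k : ℝ)))
    (by
      have h := Finset.prod_univ_sum (fun _ : Fin K => (Finset.univ : Finset Bool))
        (fun k (b : Bool) =>
          if b then ENNReal.ofReal (p k : ℝ) else ENNReal.ofReal (1 - (p k : ℝ)))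
      rw [Fintype.piFinset_univ] at h
      rw [← h]
      refine Finset.prod_eq_one fun k _ => ?_
      rw [Fintype.sum_bool]
      simp only [if_true, Bool.false_eq_true, if_false]
      rw [← ENNReal.ofReal_add (p k).2.1 (sub_nonneg.2 (p k).2.2)]
      simp)

/-- Semi-bandit feedback: the outcomes of the base arms in the played super arm `S` are revealed,
the other outcomes are masked (set to `false`). -/
def observe {K : ℕ} (S : Finset (Fin K)) (x : Fin K → Bool) : Fin K → Bool :=
  fun k => decide (k ∈ S) && x k

/-- What is recorded in one round: the super arm played (a member of the family `F` of feasible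
super arms) and the semi-bandit feedback. -/
abbrev Round (K : ℕ) (F : Finset (Finset (Fin K))) : Type :=
  {S : Finset (Fin K) // S ∈ F} × (Fin K → Bool)

/-- A (randomized, history-dependent) policy: after `t` rounds it draws the next feasible
super arm from a distribution that depends on the past actions and feedback. -/
abbrev Policy (K : ℕ) (F : Finset (Finset (Fin K))) : Type :=
  ∀ t : ℕ, (Fin t → Round K F) → PMF {S : Finset (Fin K) // S ∈ F}

/-- The law of the first `t` rounds when policy `π` faces the nonstationary Bernoulli environment
in which arm `k` has mean `μ s k` in round `s` (rounds are numbered `0, 1, 2, …`). -/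
def historyLaw {K : ℕ} {F : Finset (Finset (Fin K))} (π : Policy K F) (μ : ℕ → Fin K → I) :
    ∀ t : ℕ, PMF (Fin t → Round K F)
  | 0 => PMF.pure Fin.elim0
  | t + 1 =>
    (historyLaw π μ t).bind fun h =>
      (π t h).bind fun S =>
        (outcomeLaw (μ t)).map fun x =>
          Fin.snoc (α := fun _ => Round K F) h (S, observe S.1 x)

/-- The expected regret over the rounds `0, …, T - 1`, for the expected-reward function `r`
(`r m S` is the expected reward of super arm `S` under the vector `m` of arm means):
`𝔼[∑ t, (max_{S ∈ F} r (μ t) S - r (μ t) (S t))]`. -/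
def regret {K : ℕ} {F : Finset (Finset (Fin K))} (r : (Fin K → ℝ) → Finset (Fin K) → ℝ)
    (π : Policy K F) (μ : ℕ → Fin K → I) (T : ℕ) : ℝ :=
  ∑ h : Fin T → Round K F, (historyLaw π μ T h).toReal *
    ∑ t : Fin T, ((⨆ S : {S : Finset (Fin K) // S ∈ F}, r (fun k => (μ t k : ℝ)) S.1)
      - r (fun k => (μ t k : ℝ)) (h t).1.1)

/-- The linear reward function: the sum of the means of the arms in the super arm. -/
def linearReward {K : ℕ} (m : Fin K → ℝ) (S : Finset (Fin K)) : ℝ := ∑ k ∈ S, m k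

/-- The family of all one-element super arms (the classical `K`-armed bandit). -/
def singletons (K : ℕ) : Finset (Finset (Fin K)) := Finset.powersetCard 1 Finset.univ

/-- The number of stationary segments of an environment over the rounds `0, …, T - 1` (for `T ≥ 1`):
one plus the number of rounds after which the vector of arm means changes. -/
def numSegments {K : ℕ} (μ : ℕ → Fin K → I) (T : ℕ) : ℕ :=
  1 + Set.ncard {t : ℕ | t + 1 < T ∧ μ t ≠ μ (t + 1)}

/-- The arms that may be optimal in the segment following segments `0, …, n - 1` with optimal arms
`b`: all arms if `n = 0`, otherwise all arms but the last entry of `b`. -/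
def nextArms {K n : ℕ} (b : Fin n → Fin K) : Finset (Fin K) :=
  Finset.univ.filter fun k => ∀ j : Fin n, (j : ℕ) + 1 = n → k ≠ b j

theorem nextArms_nonempty {K n : ℕ} (hK : 2 ≤ K) (b : Fin n → Fin K) :
    (nextArms b).Nonempty := by
  have : Nontrivial (Fin K) := Fin.nontrivial_iff_two_le.2 hK
  rcases n with _ | n
  · exact ⟨⟨0, by omega⟩, by simp only [nextArms, Finset.mem_filter, Finset.mem_univ, true_and]
                             exact fun j => j.elim0⟩
  · obtain ⟨k, hk⟩ := exists_ne (b (Fin.last n))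
    refine ⟨k, ?_⟩
    simp only [nextArms, Finset.mem_filter, Finset.mem_univ, true_and]
    intro j hj
    have : j = Fin.last n := Fin.ext (by simpa using hj)
    rwa [this]

/-- The law of the optimal arms of the first `n` segments: the first one is uniform over all arms,
and each next one is uniform over the arms different from its predecessor. -/
def bestArmLaw {K : ℕ} (hK : 2 ≤ K) : ∀ n : ℕ, PMF (Fin n → Fin K)
  | 0 => PMF.pure Fin.elim0
  | n + 1 =>
    (bestArmLaw hK n).bind fun b =>
      (PMF.uniformOfFinset (nextArms b) (nextArms_nonempty hK b)).map fun k =>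
        Fin.snoc (α := fun _ => Fin K) b k

/-- The segment that round `t` of `T` belongs to: the segments `0, …, N - 2` have length `⌈T / N⌉`
each, and the last one consists of the remaining rounds. -/
def segment (T N : ℕ) (hN : 0 < N) (t : ℕ) : Fin N :=
  ⟨min (t / ⌈(T : ℝ) / (N : ℝ)⌉₊) (N - 1), by omega⟩

/-- The environment with optimal arms `b`: in every round the optimal arm of the current segment
has mean `1 / 2 + ε` and all other arms have mean `1 / 2`. (The projection to `[0, 1]` does nothing
for `0 ≤ ε ≤ 1 / 2`.) -/
def hardMeans {K N : ℕ} (T : ℕ) (hN : 0 < N) (ε : ℝ) (b : Fin N → Fin K) : ℕ → Fin K → I :=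
  fun t k => Set.projIcc (0 : ℝ) 1 zero_le_one
    (if k = b (segment T N hN t) then 1 / 2 + ε else 1 / 2)

/-- The expected regret of `π` on the randomized instance: the optimal arms are drawn from
`bestArmLaw`, then the policy (which does not see them) plays `T` rounds. -/
def hardRegret {K N : ℕ} (hK : 2 ≤ K) (hN : 0 < N) (T : ℕ) (ε : ℝ)
    (π : Policy K (singletons K)) : ℝ :=
  ∑ b : Fin N → Fin K, (bestArmLaw hK N b).toReal *
    regret linearReward π (hardMeans T hN ε b) T

end SemiBandit

end

/-! With one optimal arm per segment, the regret is `ε` times the expected number of rounds in which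
that arm is not played. So it suffices to bound, round by round, the probability of playing it.

Fix a round `t` and the optimal arms of the earlier segments. Later segments are irrelevant by
causality, and the optimal arm of the current segment is uniform over a set `A` of at least `K - 1`
arms. Let `m` be the number of earlier rounds in the segment of `t`. Compare with the environment
that has no optimal arm in this segment. By Pinsker's inequality and the chain rule for relative
entropy, making `k` optimal raises the probability of playing `k` by at most `√(4 ε² log(4/3) x k)`,
where `x k` is the expected number of plays of `k` in these `m` rounds of the reference environment.
Since `∑ x k ≤ m`, Cauchy-Schwarz shows that the average over `A` exceeds `1 / |A|` by only `O(ε √(m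
/ K))` (`sum_playProb_update_le`; two candidates need a direct comparison). Summing `√m` over all
rounds gives order `T √(T / N)` (`sum_sqrt_offset_le`), hence the first bound; the tuned `ε`
maximizes it.

The argument uses only that segments are monotone in time and no longer than `⌈T / N⌉`. Segments of
length exactly `⌈T / N⌉` may exhaust the horizon before there are `N` of them, so the deterministic
instance uses balanced segments instead. Some choice of optimal arms in the support of their law
does at least as badly as the average. -/

noncomputable section

namespace SemiBandit

/-! ### Finite expectations, Hoeffding's lemma and Pinsker's inequality. -/

section Expectation

variable {α β : Type*} [Fintype α] [Fintype β]

/-- The expectation of `f` under a probability mass function on a finite type. -/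
def ev (p : PMF α) (f : α → ℝ) : ℝ := ∑ a, (p a).toReal * f a

theorem sum_toReal (p : PMF α) : ∑ a, (p a).toReal = 1 := by
  rw [← ENNReal.toReal_sum fun a _ => p.apply_ne_top a, ← tsum_fintype (L := .unconditional _),
    p.tsum_coe, ENNReal.toReal_one]

theorem ev_const (p : PMF α) (c : ℝ) : ev p (fun _ => c) = c := by
  rw [ev, ← Finset.sum_mul, sum_toReal, one_mul]

theorem ev_add (p : PMF α) (f g : α → ℝ) : ev p (fun a => f a + g a) = ev p f + ev p g := by
  simp only [ev, mul_add, Finset.sum_add_distrib]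

theorem ev_sub (p : PMF α) (f g : α → ℝ) : ev p (fun a => f a - g a) = ev p f - ev p g := by
  simp only [ev, mul_sub, Finset.sum_sub_distrib]

theorem ev_const_mul (p : PMF α) (c : ℝ) (f : α → ℝ) :
    ev p (fun a => c * f a) = c * ev p f := by
  simp only [ev, Finset.mul_sum]
  exact Finset.sum_congr rfl fun a _ => by ring

theorem ev_sum {ι : Type*} (p : PMF α) (s : Finset ι) (f : ι → α → ℝ) :
    ev p (fun a => ∑ i ∈ s, f i a) = ∑ i ∈ s, ev p (f i) := by
  simp only [ev, Finset.mul_sum]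
  exact Finset.sum_comm

theorem ev_mono (p : PMF α) {f g : α → ℝ} (h : ∀ a, f a ≤ g a) : ev p f ≤ ev p g :=
  Finset.sum_le_sum fun a _ => mul_le_mul_of_nonneg_left (h a) ENNReal.toReal_nonneg

theorem ev_nonneg (p : PMF α) {f : α → ℝ} (h : ∀ a, 0 ≤ f a) : 0 ≤ ev p f :=
  Finset.sum_nonneg fun a _ => mul_nonneg ENNReal.toReal_nonneg (h a)

theorem ev_le_of_le (p : PMF α) {f : α → ℝ} {c : ℝ} (h : ∀ a, f a ≤ c) : ev p f ≤ c :=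
  (ev_mono p h).trans_eq (ev_const p c)

theorem ev_pure (a : α) (f : α → ℝ) : ev (PMF.pure a) f = f a := by
  classical
  rw [ev, Finset.sum_eq_single a]
  · simp
  · intro b _ hb
    simp [PMF.pure_apply, hb]
  · simp

theorem ev_bind (p : PMF α) (q : α → PMF β) (f : β → ℝ) :
    ev (p.bind q) f = ev p fun a => ev (q a) f := by
  have h : ∀ b, (p.bind q b).toReal = ∑ a, (p a).toReal * (q a b).toReal := fun b => by
    rw [PMF.bind_apply, tsum_fintype, ENNReal.toReal_sum]
    · simp only [ENNReal.toReal_mul]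
    · exact fun a _ => ENNReal.mul_ne_top (p.apply_ne_top a) ((q a).apply_ne_top b)
  simp only [ev, h, Finset.sum_mul, Finset.mul_sum]
  rw [Finset.sum_comm]
  exact Finset.sum_congr rfl fun a _ => Finset.sum_congr rfl fun b _ => by ring

theorem ev_map (p : PMF α) (u : α → β) (f : β → ℝ) :
    ev (p.map u) f = ev p fun a => f (u a) := by
  rw [PMF.map, ev_bind]
  simp only [Function.comp_apply, ev_pure]

/-- Positive mass matters: only in the support of `bestArmLaw` do consecutive segments have
different optimal arms. -/
theorem exists_pos_and_le_of_le_ev (p : PMF α) {f : α → ℝ} {c : ℝ} (h : c ≤ ev p f) :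
    ∃ a, p a ≠ 0 ∧ c ≤ f a := by
  by_contra! hlt
  have hle : ∀ a, (p a).toReal * f a ≤ (p a).toReal * c := fun a => by
    by_cases ha : p a = 0
    · simp [ha]
    · exact mul_le_mul_of_nonneg_left (hlt a ha).le ENNReal.toReal_nonneg
  obtain ⟨a, ha⟩ := p.support_nonempty
  rw [PMF.mem_support_iff] at ha
  have : ev p f < ev p fun _ => c :=
    Finset.sum_lt_sum (fun a _ => hle a) ⟨a, Finset.mem_univ a,
      mul_lt_mul_of_pos_left (hlt a ha) (ENNReal.toReal_pos ha (p.apply_ne_top a))⟩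
  rw [ev_const] at this
  exact absurd h this.not_ge

theorem exp_ev_le (p : PMF α) (f : α → ℝ) : Real.exp (ev p f) ≤ ev p fun a => Real.exp (f a) := by
  simpa [ev] using convexOn_exp.map_sum_le (t := Finset.univ) (w := fun a => (p a).toReal) (p := f)
    (fun a _ => ENNReal.toReal_nonneg) (sum_toReal p) (fun a _ => Set.mem_univ _)

/-- Hoeffding's lemma. -/
theorem ev_exp_le (p : PMF α) {g : α → ℝ} (h0 : ∀ a, 0 ≤ g a) (h1 : ∀ a, g a ≤ 1) (x : ℝ) :
    (ev p fun a => Real.exp (x * g a)) ≤ Real.exp (x * ev p g + x ^ 2 / 8) := by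
  let _ : MeasurableSpace α := ⊤
  have hev : ∀ f : α → ℝ, ∫ a, f a ∂p.toMeasure = ev p f := fun f => by
    rw [PMF.integral_eq_sum]
    simp [ev]
  have hsub := ProbabilityTheory.hasSubgaussianMGF_of_mem_Icc (μ := p.toMeasure) (X := g)
    (a := 0) (b := 1) measurable_from_top.aemeasurable
    (Filter.Eventually.of_forall fun a => ⟨h0 a, h1 a⟩)
  have := hsub.mgf_le x
  rw [ProbabilityTheory.mgf, hev, hev] at this
  have e : (fun a => Real.exp (x * g a))
      = fun a => Real.exp (x * ev p g) * Real.exp (x * (g a - ev p g)) := by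
    funext a
    rw [← Real.exp_add]
    ring_nf
  rw [e, ev_const_mul, Real.exp_add]
  refine mul_le_mul_of_nonneg_left (this.trans_eq ?_) (Real.exp_pos _).le
  congr 1
  push_cast
  norm_num
  ring

/-- Pinsker's inequality, with the log-likelihood ratio `l` of `p` against `q` given explicitly. -/
theorem sq_ev_sub_le (p q : PMF α) (l : α → ℝ)
    (hl : ∀ f : α → ℝ, ev q f = ev p fun a => f a * Real.exp (-l a))
    {g : α → ℝ} (h0 : ∀ a, 0 ≤ g a) (h1 : ∀ a, g a ≤ 1) :
    (ev q g - ev p g) ^ 2 ≤ ev p l / 2 := by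
  -- With `d = ev p g - ev q g`, Jensen and Hoeffding give `x * d - x ^ 2 / 8 ≤ ev p l` for every
  -- `x`; the left side is largest at `x = 4 * d`, where it is `2 * d ^ 2`.
  set x : ℝ := 4 * (ev p g - ev q g) with hx
  have hlow := exp_ev_le p fun a => x * g a - l a
  have hup := ev_exp_le q h0 h1 x
  rw [hl] at hup
  have e : (fun a => Real.exp (x * g a) * Real.exp (-l a))
      = fun a => Real.exp (x * g a - l a) := by
    funext a
    rw [← Real.exp_add, sub_eq_add_neg]
  rw [e] at hup
  have h := Real.exp_le_exp.1 (hlow.trans hup)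
  rw [ev_sub, ev_const_mul] at h
  rw [hx] at h
  nlinarith [h]

end Expectation

/-! ### Laws of histories: causality, change of measure, regret as a sum over rounds. -/

section History

variable {K : ℕ}

theorem ev_outcomeLaw_apply (p : Fin K → I) (k : Fin K) (f : Bool → ℝ) :
    ev (outcomeLaw p) (fun x => f (x k)) = (p k : ℝ) * f true + (1 - (p k : ℝ)) * f false := by
  have hw : ∀ x : Fin K → Bool, (outcomeLaw p x).toReal * f (x k)
      = ∏ j, (if x j then (p j : ℝ) else 1 - (p j : ℝ)) * (if j = k then f (x j) else 1) := by
    intro x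
    rw [outcomeLaw, PMF.ofFintype_apply, ENNReal.toReal_prod, Finset.prod_mul_distrib,
      Finset.prod_ite_eq' Finset.univ k fun j => f (x j)]
    simp only [Finset.mem_univ, if_true]
    congr 1
    refine Finset.prod_congr rfl fun j _ => ?_
    split_ifs
    · exact ENNReal.toReal_ofReal (p j).2.1
    · exact ENNReal.toReal_ofReal (sub_nonneg.2 (p j).2.2)
  have h := Finset.prod_univ_sum (fun _ : Fin K => (Finset.univ : Finset Bool))
    (fun j (b : Bool) =>
      (if b then (p j : ℝ) else 1 - (p j : ℝ)) * (if j = k then f b else 1))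
  rw [Fintype.piFinset_univ] at h
  rw [ev, Finset.sum_congr rfl fun x _ => hw x, ← h, Finset.prod_eq_single k]
  · simp
  · intro j _ hj
    simp [hj]
  · simp

theorem ev_historyLaw_succ {F : Finset (Finset (Fin K))} (π : Policy K F) (μ : ℕ → Fin K → I)
    (t : ℕ) (f : (Fin (t + 1) → Round K F) → ℝ) :
    ev (historyLaw π μ (t + 1)) f = ev (historyLaw π μ t) fun h => ev (π t h) fun S =>
      ev (outcomeLaw (μ t)) fun x =>
        f (Fin.snoc (α := fun _ => Round K F) h (S, observe S.1 x)) := by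
  rw [historyLaw, ev_bind]
  simp only [ev_bind, ev_map]

theorem historyLaw_congr {F : Finset (Finset (Fin K))} (π : Policy K F) {μ ν : ℕ → Fin K → I}
    {t : ℕ} (h : ∀ s < t, μ s = ν s) : historyLaw π μ t = historyLaw π ν t := by
  induction t with
  | zero => rfl
  | succ t ih =>
    rw [historyLaw, historyLaw, ih fun s hs => h s (hs.trans t.lt_succ_self), h t t.lt_succ_self]

theorem exists_eq_singleton (S : {S : Finset (Fin K) // S ∈ singletons K}) : ∃ k, S.1 = {k} :=
  Finset.card_eq_one.1 (Finset.mem_powersetCard.1 S.2).2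

/-- The arm contained in a one-element super arm. -/
def arm (S : {S : Finset (Fin K) // S ∈ singletons K}) : Fin K := (exists_eq_singleton S).choose

theorem val_eq_singleton_arm (S : {S : Finset (Fin K) // S ∈ singletons K}) : S.1 = {arm S} :=
  (exists_eq_singleton S).choose_spec

theorem observe_eq_observe_const (S : {S : Finset (Fin K) // S ∈ singletons K})
    (x : Fin K → Bool) : observe S.1 x = observe S.1 fun _ => x (arm S) := by
  funext k
  simp only [observe]
  by_cases hk : k ∈ S.1
  · rw [val_eq_singleton_arm S, Finset.mem_singleton] at hk
    rw [hk]
  · simp [hk]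

theorem observe_const_arm (S : {S : Finset (Fin K) // S ∈ singletons K}) (b : Bool) :
    observe S.1 (fun _ => b) (arm S) = b := by
  have : arm S ∈ S.1 := by
    rw [val_eq_singleton_arm S]
    exact Finset.mem_singleton_self _
  simp [observe, this]

theorem ev_outcomeLaw_observe (p : Fin K → I) (S : {S : Finset (Fin K) // S ∈ singletons K})
    (f : (Fin K → Bool) → ℝ) :
    ev (outcomeLaw p) (fun x => f (observe S.1 x))
      = (p (arm S) : ℝ) * f (observe S.1 fun _ => true)
        + (1 - (p (arm S) : ℝ)) * f (observe S.1 fun _ => false) := by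
  rw [← ev_outcomeLaw_apply p (arm S) fun b => f (observe S.1 fun _ => b)]
  simp only [← observe_eq_observe_const]

/-- The Kullback-Leibler divergence between the Bernoulli laws of means `p` and `q`. -/
def bernoulliKL (p q : ℝ) : ℝ := p * Real.log (p / q) + (1 - p) * Real.log ((1 - p) / (1 - q))

/-- The log-likelihood ratio of one round under the vectors `p` and `q` of arm means. -/
def roundLogRatio (p q : Fin K → I) (y : Round K (singletons K)) : ℝ :=
  if y.2 (arm y.1) then Real.log ((p (arm y.1) : ℝ) / (q (arm y.1) : ℝ))
  else Real.log ((1 - (p (arm y.1) : ℝ)) / (1 - (q (arm y.1) : ℝ)))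

/-- The log-likelihood ratio of a history under the environments `μ` and `ν`. -/
def logRatio (μ ν : ℕ → Fin K → I) (t : ℕ) (h : Fin t → Round K (singletons K)) : ℝ :=
  ∑ s : Fin t, roundLogRatio (μ s) (ν s) (h s)

theorem logRatio_snoc (μ ν : ℕ → Fin K → I) (t : ℕ) (h : Fin t → Round K (singletons K))
    (y : Round K (singletons K)) :
    logRatio μ ν (t + 1) (Fin.snoc (α := fun _ => Round K (singletons K)) h y)
      = logRatio μ ν t h + roundLogRatio (μ t) (ν t) y := by
  simp [logRatio, Fin.sum_univ_castSucc]

variable (π : Policy K (singletons K))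

/-- The probability that arm `k` is played in round `t`. -/
def playProb (μ : ℕ → Fin K → I) (t : ℕ) (k : Fin K) : ℝ :=
  ev (historyLaw π μ t) fun h => ev (π t h) fun S => if arm S = k then 1 else 0

theorem playProb_nonneg (μ : ℕ → Fin K → I) (t : ℕ) (k : Fin K) : 0 ≤ playProb π μ t k :=
  ev_nonneg _ fun _ => ev_nonneg _ fun _ => by split_ifs <;> norm_num

theorem ev_ev_arm (μ : ℕ → Fin K → I) (t : ℕ) (f : Fin K → ℝ) :
    (ev (historyLaw π μ t) fun h => ev (π t h) fun S => f (arm S))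
      = ∑ k, playProb π μ t k * f k := by
  have h : ∀ S : {S : Finset (Fin K) // S ∈ singletons K},
      f (arm S) = ∑ k, f k * if arm S = k then 1 else 0 := fun S => by simp
  simp only [h, ev_sum, ev_const_mul, playProb]
  exact Finset.sum_congr rfl fun k _ => mul_comm _ _

theorem sum_playProb (μ : ℕ → Fin K → I) (t : ℕ) : ∑ k, playProb π μ t k = 1 := by
  have := ev_ev_arm π μ t fun _ => 1
  simpa [ev_const] using this.symm

theorem sum_playProb_le_one (μ : ℕ → Fin K → I) (t : ℕ) (A : Finset (Fin K)) :
    ∑ k ∈ A, playProb π μ t k ≤ 1 := by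
  rw [← sum_playProb π μ t]
  exact Finset.sum_le_sum_of_subset_of_nonneg A.subset_univ fun k _ _ => playProb_nonneg π μ t k

theorem playProb_le_one (μ : ℕ → Fin K → I) (t : ℕ) (k : Fin K) : playProb π μ t k ≤ 1 := by
  simpa using sum_playProb_le_one π μ t {k}

theorem playProb_congr {μ ν : ℕ → Fin K → I} {t : ℕ} (h : ∀ s < t, μ s = ν s) :
    playProb π μ t = playProb π ν t := by
  funext k
  rw [playProb, playProb, historyLaw_congr π h]

/-- Both laws share the randomization of the policy, which cancels; only the Bernoulli likelihood
ratio of the played arm survives in each round. -/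
theorem ev_historyLaw_eq_mul_exp {μ ν : ℕ → Fin K → I} (hμ : ∀ t k, (μ t k : ℝ) ∈ Set.Ioo 0 1)
    (hν : ∀ t k, (ν t k : ℝ) ∈ Set.Ioo 0 1) (t : ℕ)
    (f : (Fin t → Round K (singletons K)) → ℝ) :
    ev (historyLaw π ν t) f
      = ev (historyLaw π μ t) fun h => f h * Real.exp (-logRatio μ ν t h) := by
  induction t with
  | zero => simp [historyLaw, ev_pure, logRatio]
  | succ t ih =>
    rw [ev_historyLaw_succ, ev_historyLaw_succ, ih]
    congr 1
    funext h
    rw [mul_comm, ← ev_const_mul]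
    congr 1
    funext S
    obtain ⟨hμ0, hμ1⟩ := hμ t (arm S)
    obtain ⟨hν0, hν1⟩ := hν t (arm S)
    have e1 := ev_outcomeLaw_observe (ν t) S fun y =>
      f (Fin.snoc (α := fun _ => Round K (singletons K)) h (S, y))
    have e2 := ev_outcomeLaw_observe (μ t) S fun y =>
      f (Fin.snoc (α := fun _ => Round K (singletons K)) h (S, y)) *
        Real.exp (-logRatio μ ν (t + 1)
          (Fin.snoc (α := fun _ => Round K (singletons K)) h (S, y)))
    rw [e1, e2]
    simp only [logRatio_snoc, roundLogRatio, observe_const_arm, if_true, Bool.false_eq_true,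
      if_false, neg_add, Real.exp_add, Real.exp_neg (Real.log _)]
    rw [Real.exp_log (div_pos hμ0 hν0),
      Real.exp_log (div_pos (sub_pos.2 hμ1) (sub_pos.2 hν1))]
    have h1 : (1 : ℝ) - (μ t (arm S) : ℝ) ≠ 0 := (sub_pos.2 hμ1).ne'
    field_simp

/-- Chain rule for relative entropy: a round contributes the divergence of the arm it plays. -/
theorem ev_logRatio (μ ν : ℕ → Fin K → I) (t : ℕ) :
    ev (historyLaw π μ t) (logRatio μ ν t)
      = ∑ s ∈ Finset.range t, ∑ k, playProb π μ s k * bernoulliKL (μ s k) (ν s k) := by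
  induction t with
  | zero => simp [historyLaw, ev_pure, logRatio]
  | succ t ih =>
    rw [ev_historyLaw_succ, Finset.sum_range_succ, ← ih,
      ← ev_ev_arm π μ t fun k => bernoulliKL (μ t k) (ν t k), ← ev_add]
    congr 1
    funext h
    simp only [logRatio_snoc, ev_add, ev_const]
    congr 2
    funext S
    rw [ev_outcomeLaw_observe (μ t) S fun y => roundLogRatio (μ t) (ν t) (S, y)]
    simp [roundLogRatio, observe_const_arm, bernoulliKL]

theorem sq_playProb_sub_le {μ ν : ℕ → Fin K → I} (hμ : ∀ t k, (μ t k : ℝ) ∈ Set.Ioo 0 1)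
    (hν : ∀ t k, (ν t k : ℝ) ∈ Set.Ioo 0 1) (t : ℕ) (k : Fin K) :
    (playProb π ν t k - playProb π μ t k) ^ 2
      ≤ (∑ s ∈ Finset.range t, ∑ j, playProb π μ s j * bernoulliKL (μ s j) (ν s j)) / 2 := by
  rw [← ev_logRatio]
  refine sq_ev_sub_le _ _ _ (ev_historyLaw_eq_mul_exp π hμ hν t) (fun h => ?_) fun h => ?_
  · exact ev_nonneg _ fun S => by split_ifs <;> norm_num
  · exact ev_le_of_le _ fun S => by split_ifs <;> norm_num

theorem regret_linearReward (μ : ℕ → Fin K → I) (T : ℕ) :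
    regret linearReward π μ T = ∑ t ∈ Finset.range T,
      ((⨆ S : {S : Finset (Fin K) // S ∈ singletons K}, linearReward (fun k => (μ t k : ℝ)) S.1)
        - ∑ k, playProb π μ t k * (μ t k : ℝ)) := by
  change ev (historyLaw π μ T) _ = _
  induction T with
  | zero => simp [historyLaw, ev_pure]
  | succ T ih =>
    rw [ev_historyLaw_succ, Finset.sum_range_succ, ← ih,
      ← ev_ev_arm π μ T fun k => (μ T k : ℝ), ← ev_const (historyLaw π μ T) (⨆ S, _), ← ev_sub,
      ← ev_add]
    congr 1
    funext h
    simp only [Fin.sum_univ_castSucc, Fin.snoc_castSucc, Fin.snoc_last, Fin.val_castSucc,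
      Fin.val_last, ev_add, ev_const, ev_sub]
    congr 3
    funext S
    rw [val_eq_singleton_arm S, linearReward, Finset.sum_singleton]

end History

/-! ### Divergence estimates and environments with at most one better arm per round. -/

section Environment

theorem log_four_thirds_le : Real.log (4 / 3) ≤ 1 / 3 := by
  linarith [Real.log_le_sub_one_of_pos (show (0 : ℝ) < 4 / 3 by norm_num)]

theorem le_log_four_thirds : 1 / 4 ≤ Real.log (4 / 3) := by
  linarith [Real.one_sub_inv_le_log_of_pos (show (0 : ℝ) < 4 / 3 by norm_num)]

theorem bernoulliKL_self (p : ℝ) : bernoulliKL p p = 0 := by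
  have h : ∀ x : ℝ, Real.log (x / x) = 0 := fun x => by
    by_cases hx : x = 0 <;> simp [hx]
  simp [bernoulliKL, h]

variable {ε : ℝ}

/-- The divergence equals `-log (1 - 4 ε²) / 2`, and by concavity `log` lies above its chord over
`[3/4, 1]`; this is the source of `log (4 / 3)`. -/
theorem bernoulliKL_half_le (h0 : 0 ≤ ε) (h1 : ε ≤ 1 / 4) :
    bernoulliKL (1 / 2) (1 / 2 + ε) ≤ 8 * ε ^ 2 * Real.log (4 / 3) := by
  have hu : 16 * ε ^ 2 ≤ 1 := by nlinarith
  have hc := strictConcaveOn_log_Ioi.concaveOn.2 (x := 1) (y := 3 / 4)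
    (Set.mem_Ioi.2 one_pos) (Set.mem_Ioi.2 (by norm_num)) (sub_nonneg.2 hu)
    (show 0 ≤ 16 * ε ^ 2 by positivity) (by ring)
  simp only [smul_eq_mul, Real.log_one, mul_zero, zero_add] at hc
  have e1 : Real.log (3 / 4) = -Real.log (4 / 3) := by
    rw [← Real.log_inv]
    norm_num
  have e2 : (1 - 16 * ε ^ 2) * 1 + 16 * ε ^ 2 * (3 / 4) = (1 + 2 * ε) * (1 - 2 * ε) := by ring
  rw [e1, e2, Real.log_mul (by linarith) (by linarith)] at hc
  have e3 : (1 / 2 : ℝ) / (1 / 2 + ε) = (1 + 2 * ε)⁻¹ := by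
    have : 1 / 2 + ε ≠ 0 := by positivity
    have : 1 + 2 * ε ≠ 0 := by positivity
    field_simp
  have e4 : (1 - 1 / 2 : ℝ) / (1 - (1 / 2 + ε)) = (1 - 2 * ε)⁻¹ := by
    have : 1 - (1 / 2 + ε) ≠ 0 := by linarith
    have : 1 - 2 * ε ≠ 0 := by linarith
    rw [inv_eq_one_div, div_eq_div_iff] <;> first | assumption | ring
  rw [bernoulliKL, e3, e4, Real.log_inv, Real.log_inv]
  linarith

/-- The series `2 ∑ x ^ (2 k + 1) / (2 k + 1)` is dominated termwise by a geometric series. -/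
theorem log_sub_log_le {x : ℝ} (h0 : 0 ≤ x) (h1 : x < 1) :
    Real.log (1 + x) - Real.log (1 - x) ≤ 2 * x / (1 - x ^ 2) := by
  have hs := Real.hasSum_log_sub_log_of_abs_lt_one (by rwa [abs_of_nonneg h0])
  have hg := (hasSum_geometric_of_lt_one (sq_nonneg x) (by nlinarith)).mul_left (2 * x)
  rw [div_eq_mul_inv]
  refine hasSum_le (fun k => ?_) hs hg
  have e : x ^ (2 * k + 1) = x * (x ^ 2) ^ k := by rw [← pow_mul]; ring
  rw [e, show 2 * x * (x ^ 2) ^ k = 2 * 1 * (x * (x ^ 2) ^ k) by ring]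
  refine mul_le_mul_of_nonneg_right ?_ (by positivity)
  refine mul_le_mul_of_nonneg_left ?_ zero_le_two
  rw [div_le_one (by positivity)]
  linarith [(Nat.cast_nonneg k : (0 : ℝ) ≤ k)]

theorem bernoulliKL_half_add_le (h0 : 0 ≤ ε) (h1 : ε ≤ 1 / 4) :
    bernoulliKL (1 / 2 + ε) (1 / 2) ≤ 10 / 3 * ε ^ 2 := by
  have hx := log_sub_log_le (x := 2 * ε) (by linarith) (by linarith)
  have hy : 2 * (2 * ε) / (1 - (2 * ε) ^ 2) ≤ 16 / 3 * ε := by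
    rw [div_le_iff₀ (by nlinarith)]
    -- Hence the denominator `1 - 4 ε²` is at least `3 / 4`.
    have : ε ^ 2 ≤ 1 / 16 := by nlinarith
    nlinarith
  have hs := Real.log_le_sub_one_of_pos (show 0 < (1 + 2 * ε) * (1 - 2 * ε) by nlinarith)
  rw [Real.log_mul (by linarith) (by linarith)] at hs
  have e1 : (1 / 2 + ε) / (1 / 2 : ℝ) = 1 + 2 * ε := by ring
  have e2 : (1 - (1 / 2 + ε)) / (1 - 1 / 2 : ℝ) = 1 - 2 * ε := by ring
  rw [bernoulliKL, e1, e2]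
  nlinarith [mul_le_mul_of_nonneg_left (hx.trans hy) h0]

theorem bernoulliKL_half_le' (h0 : 0 ≤ ε) (h1 : ε ≤ 1 / 4) :
    bernoulliKL (1 / 2) (1 / 2 + ε) ≤ 10 / 3 * ε ^ 2 := by
  refine (bernoulliKL_half_le h0 h1).trans ?_
  nlinarith [log_four_thirds_le, sq_nonneg ε]

variable {K : ℕ}

/-- The environment in which the arm `g t`, if there is one, has mean `1 / 2 + ε` in round `t` and
all other arms have mean `1 / 2`. -/
def bumpMeans (ε : ℝ) (g : ℕ → Option (Fin K)) : ℕ → Fin K → I :=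
  fun t k => Set.projIcc (0 : ℝ) 1 zero_le_one (if some k = g t then 1 / 2 + ε else 1 / 2)

theorem coe_bumpMeans (h0 : 0 ≤ ε) (h1 : ε ≤ 1 / 4) (g : ℕ → Option (Fin K)) (t : ℕ)
    (k : Fin K) : (bumpMeans ε g t k : ℝ) = if some k = g t then 1 / 2 + ε else 1 / 2 := by
  rw [bumpMeans, Set.projIcc_of_mem]
  constructor <;> split_ifs <;> linarith

theorem bumpMeans_mem_Ioo (h0 : 0 ≤ ε) (h1 : ε ≤ 1 / 4) (g : ℕ → Option (Fin K)) (t : ℕ)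
    (k : Fin K) : (bumpMeans ε g t k : ℝ) ∈ Set.Ioo 0 1 := by
  rw [coe_bumpMeans h0 h1]
  constructor <;> split_ifs <;> linarith

theorem iSup_linearReward_bumpMeans (h0 : 0 ≤ ε) (h1 : ε ≤ 1 / 4) {g : ℕ → Option (Fin K)}
    {t : ℕ} {k : Fin K} (hk : g t = some k) :
    (⨆ S : {S : Finset (Fin K) // S ∈ singletons K},
      linearReward (fun j => (bumpMeans ε g t j : ℝ)) S.1) = 1 / 2 + ε := by
  have hmem : {k} ∈ singletons K := by simp [singletons]
  have : Nonempty {S : Finset (Fin K) // S ∈ singletons K} := ⟨⟨{k}, hmem⟩⟩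
  refine le_antisymm (ciSup_le fun S => ?_) ?_
  · rw [val_eq_singleton_arm S, linearReward, Finset.sum_singleton, coe_bumpMeans h0 h1]
    split_ifs <;> linarith
  · refine le_trans ?_ (le_ciSup (Set.finite_range _).bddAbove ⟨{k}, hmem⟩)
    rw [linearReward, Finset.sum_singleton, coe_bumpMeans h0 h1, if_pos hk.symm]

variable (π : Policy K (singletons K))

theorem regret_bumpMeans (h0 : 0 ≤ ε) (h1 : ε ≤ 1 / 4) (a : ℕ → Fin K) (T : ℕ) :
    regret linearReward π (bumpMeans ε fun t => some (a t)) T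
      = ∑ t ∈ Finset.range T,
        ε * (1 - playProb π (bumpMeans ε fun t => some (a t)) t (a t)) := by
  rw [regret_linearReward]
  refine Finset.sum_congr rfl fun t _ => ?_
  rw [iSup_linearReward_bumpMeans h0 h1 rfl]
  have e : ∀ k, playProb π (bumpMeans ε fun t => some (a t)) t k
        * (bumpMeans ε (fun t => some (a t)) t k : ℝ)
      = playProb π (bumpMeans ε fun t => some (a t)) t k * (1 / 2)
        + if k = a t then playProb π (bumpMeans ε fun t => some (a t)) t k * ε else 0 := by
    intro k
    rw [coe_bumpMeans h0 h1]
    simp only [Option.some.injEq]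
    split_ifs <;> ring
  rw [Finset.sum_congr rfl fun k _ => e k, Finset.sum_add_distrib, ← Finset.sum_mul, sum_playProb,
    Finset.sum_ite_eq']
  simp only [Finset.mem_univ, if_true]
  ring

/-- The two environments differ only at arm `k` in rounds of `J`, so only plays of `k` there carry
information. -/
theorem sq_playProb_sub_le_of_none (h0 : 0 ≤ ε) (h1 : ε ≤ 1 / 4) {g g' : ℕ → Option (Fin K)}
    (J : ℕ → Prop) [DecidablePred J] {k : Fin K} (hg : ∀ s, J s → g s = none)
    (hg' : ∀ s, J s → g' s = some k) (hgg' : ∀ s, ¬J s → g s = g' s) (t : ℕ) (j : Fin K) :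
    (playProb π (bumpMeans ε g') t j - playProb π (bumpMeans ε g) t j) ^ 2
      ≤ 4 * ε ^ 2 * Real.log (4 / 3)
        * ∑ s ∈ Finset.range t with J s, playProb π (bumpMeans ε g) s k := by
  refine (sq_playProb_sub_le π (bumpMeans_mem_Ioo h0 h1 g) (bumpMeans_mem_Ioo h0 h1 g') t j).trans
    ?_
  rw [div_le_iff₀ two_pos, Finset.mul_sum, Finset.sum_mul, Finset.sum_filter]
  refine Finset.sum_le_sum fun s _ => ?_
  simp only [coe_bumpMeans h0 h1]
  split_ifs with hs
  · rw [Finset.sum_eq_single k]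
    · simp only [hg s hs, hg' s hs, reduceCtorEq, if_true, if_false]
      have := mul_le_mul_of_nonneg_left (bernoulliKL_half_le h0 h1)
        (playProb_nonneg π (bumpMeans ε g) s k)
      linarith
    · intro l _ hl
      simp [hg s hs, hg' s hs, hl, bernoulliKL_self]
    · simp
  · simp [hgg' s hs, bernoulliKL_self]

/-- A cruder estimate: every round of `J` is charged the worst divergence, whichever arm is played.
-/
theorem sq_playProb_sub_le_of_some (h0 : 0 ≤ ε) (h1 : ε ≤ 1 / 4) {g g' : ℕ → Option (Fin K)}
    (J : ℕ → Prop) [DecidablePred J] (hgg' : ∀ s, ¬J s → g s = g' s) (t : ℕ) (j : Fin K) :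
    (playProb π (bumpMeans ε g') t j - playProb π (bumpMeans ε g) t j) ^ 2
      ≤ 5 / 3 * ε ^ 2 * ((Finset.range t).filter J).card := by
  refine (sq_playProb_sub_le π (bumpMeans_mem_Ioo h0 h1 g) (bumpMeans_mem_Ioo h0 h1 g') t j).trans
    ?_
  rw [div_le_iff₀ two_pos, Finset.card_filter, Nat.cast_sum, Finset.mul_sum, Finset.sum_mul]
  refine Finset.sum_le_sum fun s _ => ?_
  simp only [coe_bumpMeans h0 h1]
  split_ifs with hs
  · have hkl : ∀ l, bernoulliKL (if some l = g s then 1 / 2 + ε else 1 / 2)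
        (if some l = g' s then 1 / 2 + ε else 1 / 2) ≤ 10 / 3 * ε ^ 2 := fun l => by
      split_ifs
      · exact (bernoulliKL_self _).trans_le (by positivity)
      · exact bernoulliKL_half_add_le h0 h1
      · exact bernoulliKL_half_le' h0 h1
      · exact (bernoulliKL_self _).trans_le (by positivity)
    refine (Finset.sum_le_sum fun l _ =>
      mul_le_mul_of_nonneg_left (hkl l) (playProb_nonneg π _ s l)).trans_eq ?_
    rw [← Finset.sum_mul, sum_playProb]
    push_cast
    ring
  · simp [hgg' s hs, bernoulliKL_self]

/-! ### Probability of playing a random optimal arm in one round. -/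

/-- The number of rounds before `t` that belong to the same segment as `t`. -/
def offset {N : ℕ} (seg : ℕ → Fin N) (t : ℕ) : ℕ :=
  ((Finset.range t).filter fun s => seg s = seg t).card

/-- If the optimal arm of the segment of round `t` is drawn uniformly from a set `A` of at least
`K - 1` arms, then in round `t` it is played with probability little more than `1 / 2`. -/
theorem sum_playProb_update_le (hK : 3 ≤ K) (h0 : 0 ≤ ε) (h1 : ε ≤ 1 / 4) {N : ℕ}
    (seg : ℕ → Fin N) (b : Fin N → Fin K) (t : ℕ) (A : Finset (Fin K)) (hA : K ≤ A.card + 1) :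
    ∑ k ∈ A, playProb π
        (bumpMeans ε fun s => some (Function.update b (seg t) k (seg s))) t k
      ≤ A.card * (1 / 2 + 3 / 2 * ε * (√(K * Real.log (4 / 3)) / (K - 1)) * √(offset seg t)) := by
  have hK' : (3 : ℝ) ≤ K := by exact_mod_cast hK
  have hA' : (K : ℝ) ≤ A.card + 1 := by exact_mod_cast hA
  have hlog := le_log_four_thirds
  set c : ℝ := √(K * Real.log (4 / 3)) / (K - 1) with hc
  have hc0 : 0 ≤ c := div_nonneg (Real.sqrt_nonneg _) (by linarith)
  have hc2 : c ^ 2 * (K - 1) ^ 2 = K * Real.log (4 / 3) := by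
    rw [hc, div_pow, Real.sq_sqrt (by positivity)]
    have : (K : ℝ) - 1 ≠ 0 := by linarith
    field_simp
  set r : ℝ := √(offset seg t) with hr
  have hr0 : 0 ≤ r := Real.sqrt_nonneg _
  have hr2 : r ^ 2 = offset seg t := Real.sq_sqrt (Nat.cast_nonneg _)
  rcases le_or_gt 3 A.card with h3 | h3
  · have h3' : (3 : ℝ) ≤ A.card := by exact_mod_cast h3
    -- The reference environment, with no optimal arm in the segment of `t`; it does not depend on
    -- `k`, so its play probabilities can be summed over `A`.
    set g : ℕ → Option (Fin K) := fun s => if seg s = seg t then none else some (b (seg s)) with hg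
    set x : Fin K → ℝ := fun k =>
      ∑ s ∈ Finset.range t with seg s = seg t, playProb π (bumpMeans ε g) s k with hx
    have hx0 : ∀ k, 0 ≤ x k := fun k => Finset.sum_nonneg fun s _ => playProb_nonneg π _ s k
    have hxsum : ∑ k ∈ A, x k ≤ r ^ 2 := by
      rw [hx, Finset.sum_comm, hr2, offset]
      refine (Finset.sum_le_sum fun s _ => sum_playProb_le_one π _ s A).trans_eq ?_
      simp
    set y : ℝ := 2 * ε * c * r with hy
    have hy0 : 0 ≤ y := by positivity
    have hcs : ∑ k ∈ A, √(4 * ε ^ 2 * Real.log (4 / 3) * x k) ≤ A.card * y := by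
      refine (abs_le_of_sq_le_sq' ?_ (mul_nonneg (Nat.cast_nonneg _) hy0)).2
      refine sq_sum_le_card_mul_sum_sq.trans ?_
      have e : ∀ k ∈ A, √(4 * ε ^ 2 * Real.log (4 / 3) * x k) ^ 2
          = 4 * ε ^ 2 * Real.log (4 / 3) * x k := fun k _ =>
        Real.sq_sqrt (mul_nonneg (by positivity) (hx0 k))
      rw [Finset.sum_congr rfl e, ← Finset.mul_sum]
      have hlc : Real.log (4 / 3) ≤ A.card * c ^ 2 := by
        have h2 : (K - 1) ^ 2 * Real.log (4 / 3) ≤ (K - 1) ^ 2 * (A.card * c ^ 2) := by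
          have : ((K : ℝ) - 1) ^ 2 ≤ A.card * K := by nlinarith
          nlinarith
        exact le_of_mul_le_mul_left h2 (by nlinarith)
      have hx0' : 0 ≤ ∑ k ∈ A, x k := Finset.sum_nonneg fun k _ => hx0 k
      calc A.card * (4 * ε ^ 2 * Real.log (4 / 3) * ∑ k ∈ A, x k)
          ≤ A.card * (4 * ε ^ 2 * (A.card * c ^ 2) * r ^ 2) := by gcongr
        _ = (A.card * y) ^ 2 := by rw [hy]; ring
    have hle : ∀ k ∈ A, playProb π
        (bumpMeans ε fun s => some (Function.update b (seg t) k (seg s))) t k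
        ≤ playProb π (bumpMeans ε g) t k + √(4 * ε ^ 2 * Real.log (4 / 3) * x k) := by
      intro k _
      have := sq_playProb_sub_le_of_none π h0 h1 (g := g)
        (g' := fun s => some (Function.update b (seg t) k (seg s))) (fun s => seg s = seg t)
        (k := k) (fun s hs => by simp [hg, hs]) (fun s hs => by simp [hs])
        (fun s hs => by simp [hg, hs]) t k
      linarith [Real.le_sqrt_of_sq_le this]
    have hS := Finset.sum_le_sum hle
    rw [Finset.sum_add_distrib] at hS
    have hS1 := sum_playProb_le_one π (bumpMeans ε g) t A
    have hS2 := Finset.sum_le_card_nsmul A (fun k => playProb π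
        (bumpMeans ε fun s => some (Function.update b (seg t) k (seg s))) t k) 1
        fun k _ => playProb_le_one π _ t k
    rw [nsmul_eq_mul, mul_one] at hS2
    have e : 3 / 2 * ε * c * r = 3 / 4 * y := by rw [hy]; ring
    rw [e]
    -- The sum is at most `|A|` and at most `1 + |A| * y`. The target `|A| * (1 / 2 + 3 / 4 * y)`
    -- exceeds the first when `y ≥ 2 / 3`, and the second when `y < 2 / 3` because `|A| ≥ 3`.
    rcases le_or_gt (2 / 3) y with hy' | hy'
    · nlinarith
    · nlinarith
  -- With two candidates the base value `1 / |A|` is already `1 / 2`, leaving no slack to reduce the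
  -- factor `2` to `3 / 2`. The two environments are compared with each other instead.
  · obtain rfl : K = 3 := by omega
    obtain ⟨k, l, hkl, rfl⟩ := Finset.card_eq_two.1 (show A.card = 2 by omega)
    rw [Finset.sum_pair hkl, Finset.card_pair hkl]
    have hpair := sum_playProb_le_one π
      (bumpMeans ε fun s => some (Function.update b (seg t) k (seg s))) t {k, l}
    rw [Finset.sum_pair hkl] at hpair
    have := sq_playProb_sub_le_of_some π h0 h1
      (g := fun s => some (Function.update b (seg t) k (seg s)))
      (g' := fun s => some (Function.update b (seg t) l (seg s))) (fun s => seg s = seg t)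
      (fun s hs => by simp [hs]) t l
    change _ ≤ 5 / 3 * ε ^ 2 * (offset seg t : ℝ) at this
    rw [← hr2] at this
    have hd := abs_le_of_sq_le_sq' (b := 3 * ε * c * r) (this.trans ?_) (by positivity) |>.2
    · push_cast
      linarith
    · push_cast at hc2
      -- For `K = 3`, `c ^ 2 = 3 * log (4 / 3) / 4 ≥ 3 / 16`, and `27 / 16 ≥ 5 / 3`.
      have : 5 / 3 ≤ 9 * c ^ 2 := by nlinarith
      calc 5 / 3 * ε ^ 2 * r ^ 2 ≤ 9 * c ^ 2 * ε ^ 2 * r ^ 2 := by gcongr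
        _ = (3 * ε * c * r) ^ 2 := by ring

end Environment

/-! ### The law of the optimal arms. -/

section BestArms

variable {K : ℕ}

theorem le_card_nextArms_add_one {n : ℕ} (b : Fin n → Fin K) : K ≤ (nextArms b).card + 1 := by
  rcases n with _ | n
  · have : nextArms b = Finset.univ :=
      Finset.filter_true_of_mem fun k _ j => j.elim0
    simp [this]
  · have hsub : Finset.univ.erase (b (Fin.last n)) ⊆ nextArms b := fun k hk => by
      simp only [nextArms, Finset.mem_filter, Finset.mem_univ, true_and]
      intro j hj
      have : j = Fin.last n := Fin.ext (by simpa using hj)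
      rw [this]
      exact (Finset.mem_erase.1 hk).1
    have := Finset.card_le_card hsub
    rw [Finset.card_erase_of_mem (Finset.mem_univ _), Finset.card_fin] at this
    omega

theorem ev_uniformOfFinset {α : Type*} [Fintype α] (s : Finset α) (hs : s.Nonempty) (f : α → ℝ) :
    ev (PMF.uniformOfFinset s hs) f = (∑ a ∈ s, f a) / s.card := by
  classical
  simp only [ev, PMF.uniformOfFinset_apply]
  rw [Finset.sum_div, ← Finset.sum_filter_add_sum_filter_not Finset.univ (· ∈ s),
    Finset.sum_congr rfl (g := fun a => f a / s.card), Finset.sum_eq_zero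
      (s := Finset.univ.filter (· ∉ s)), add_zero, Finset.filter_mem_eq_inter, Finset.univ_inter]
  · intro a ha
    simp [(Finset.mem_filter.1 ha).2]
  · intro a ha
    simp [(Finset.mem_filter.1 ha).2, div_eq_inv_mul]

/-- Under `bestArmLaw`, the average over the optimal arm of segment `i` may be taken first, if the
later segments do not matter. -/
theorem ev_bestArmLaw_le (hK : 2 ≤ K) {C : ℝ} {n : ℕ} (i : Fin n) (f : (Fin n → Fin K) → ℝ)
    (hf : ∀ b b', (∀ j ≤ i, b j = b' j) → f b = f b')
    (hC : ∀ (b : Fin n → Fin K) (A : Finset (Fin K)), K ≤ A.card + 1 →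
      ∑ k ∈ A, f (Function.update b i k) ≤ A.card * C) :
    ev (bestArmLaw hK n) f ≤ C := by
  induction n with
  | zero => exact i.elim0
  | succ n ih =>
    have k₀ : Fin K := ⟨0, by omega⟩
    rw [bestArmLaw, ev_bind]
    simp only [ev_map]
    cases i using Fin.lastCases with
    | last =>
      refine ev_le_of_le _ fun b => ?_
      have hcard : (0 : ℝ) < (nextArms b).card :=
        Nat.cast_pos.2 (nextArms_nonempty hK b).card_pos
      rw [ev_uniformOfFinset, div_le_iff₀ hcard, mul_comm]
      refine le_trans (le_of_eq ?_)
        (hC (Fin.snoc (α := fun _ => Fin K) b k₀) _ (le_card_nextArms_add_one b))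
      exact Finset.sum_congr rfl fun k _ => by rw [Fin.update_snoc_last]
    -- The last coordinate comes after `i` and does not affect `f`, so it can be frozen at an
    -- arbitrary arm `k₀`.
    | cast i =>
      have e : ∀ b : Fin n → Fin K, (ev (PMF.uniformOfFinset (nextArms b)
          (nextArms_nonempty hK b)) fun k => f (Fin.snoc (α := fun _ => Fin K) b k))
          = f (Fin.snoc (α := fun _ => Fin K) b k₀) := fun b => by
        rw [← ev_const (PMF.uniformOfFinset (nextArms b) (nextArms_nonempty hK b))
          (f (Fin.snoc (α := fun _ => Fin K) b k₀))]
        congr 1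
        funext k
        refine hf _ _ fun j hj => ?_
        cases j using Fin.lastCases with
        | last => exact absurd (Fin.castSucc_lt_last i) hj.not_gt
        | cast j => simp
      simp only [e]
      refine ih i _ (fun b b' h => hf _ _ fun j hj => ?_) fun b A hA => ?_
      · cases j using Fin.lastCases with
        | last => simp
        | cast j => simpa using h j (Fin.castSucc_le_castSucc_iff.1 hj)
      · simpa only [Fin.snoc_update] using hC (Fin.snoc (α := fun _ => Fin K) b k₀) A hA

theorem ne_of_bestArmLaw_ne_zero (hK : 2 ≤ K) {n : ℕ} {b : Fin n → Fin K}
    (hb : bestArmLaw hK n b ≠ 0) {i j : Fin n} (hij : (i : ℕ) + 1 = j) : b i ≠ b j := by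
  induction n with
  | zero => exact i.elim0
  | succ n ih =>
    rw [← PMF.mem_support_iff, bestArmLaw, PMF.mem_support_bind_iff] at hb
    obtain ⟨c, hc, hb⟩ := hb
    rw [PMF.mem_support_map_iff] at hb
    obtain ⟨k, hk, rfl⟩ := hb
    rw [PMF.mem_support_uniformOfFinset_iff, nextArms, Finset.mem_filter] at hk
    cases i using Fin.lastCases with
    | last => exact absurd j.isLt (by simp at hij; omega)
    | cast i =>
      cases j using Fin.lastCases with
      | last =>
        rw [Fin.snoc_castSucc, Fin.snoc_last]
        exact (hk.2 i (by simpa using hij)).symm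
      | cast j =>
        rw [Fin.snoc_castSucc, Fin.snoc_castSucc]
        exact ih ((PMF.mem_support_iff _ _).1 hc) (by simpa using hij)

end BestArms

/-! ### Summation over rounds and the bound for the randomized instance. -/

section Bound

/-- A discrete form of `∫ √x = (2 / 3) x ^ (3 / 2)`. Having `L - 1` under the root absorbs the
ceiling, as `⌈T / N⌉ - 1 ≤ T / N`. -/
theorem sum_range_sqrt_le {l L : ℕ} (h : l ≤ L) :
    ∑ j ∈ Finset.range l, √(j : ℝ) ≤ 2 / 3 * l * √((L : ℝ) - 1) := by
  induction l generalizing L with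
  | zero => simp
  | succ l ih =>
    have hL : √(l : ℝ) ≤ √((L : ℝ) - 1) := by
      refine Real.sqrt_le_sqrt ?_
      have : ((l + 1 : ℕ) : ℝ) ≤ L := by exact_mod_cast h
      push_cast at this
      linarith
    refine le_trans ?_ (mul_le_mul_of_nonneg_left hL (by positivity))
    rw [Finset.sum_range_succ]
    have key : (l : ℝ) * √((l : ℝ) - 1) ≤ (l - 1 / 2) * √(l : ℝ) := by
      rcases Nat.eq_zero_or_pos l with rfl | hl
      · simp
      · have hl' : (1 : ℝ) ≤ l := by exact_mod_cast hl
        refine (abs_le_of_sq_le_sq' ?_ (mul_nonneg (by linarith) (Real.sqrt_nonneg _))).2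
        rw [mul_pow, mul_pow, Real.sq_sqrt (by linarith), Real.sq_sqrt (by linarith)]
        nlinarith
    have := ih le_rfl
    push_cast
    linarith

/-- Within each segment the offsets run through `0, 1, 2, …` once each. -/
theorem sum_sqrt_offset {N : ℕ} (seg : ℕ → Fin N) (T : ℕ) :
    ∑ t ∈ Finset.range T, √(offset seg t : ℝ)
      = ∑ i, ∑ j ∈ Finset.range ((Finset.range T).filter fun s => seg s = i).card, √(j : ℝ) := by
  induction T with
  | zero => simp
  | succ T ih =>
    have e : ∀ i, ∑ j ∈ Finset.range ((Finset.range (T + 1)).filter fun s => seg s = i).card,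
          √(j : ℝ)
        = ∑ j ∈ Finset.range ((Finset.range T).filter fun s => seg s = i).card, √(j : ℝ)
          + if seg T = i then √(offset seg T : ℝ) else 0 := by
      intro i
      rw [Finset.range_add_one, Finset.filter_insert]
      split_ifs with h
      · rw [Finset.card_insert_of_notMem (by simp), Finset.sum_range_succ, offset, h]
      · rw [add_zero]
    rw [Finset.sum_range_succ, ih, Finset.sum_congr rfl fun i _ => e i, Finset.sum_add_distrib,
      Finset.sum_ite_eq]
    simp

theorem sum_sqrt_offset_le {N T : ℕ} (seg : ℕ → Fin N)
    (hseg : ∀ i, ((Finset.range T).filter fun s => seg s = i).card ≤ ⌈(T : ℝ) / N⌉₊) :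
    ∑ t ∈ Finset.range T, √(offset seg t : ℝ) ≤ 2 / 3 * T * √((T : ℝ) / N) := by
  rw [sum_sqrt_offset]
  refine (Finset.sum_le_sum fun i _ => sum_range_sqrt_le (hseg i)).trans ?_
  rw [← Finset.sum_mul, ← Finset.mul_sum, ← Nat.cast_sum,
    ← Finset.card_eq_sum_card_fiberwise fun _ _ => Finset.mem_univ _, Finset.card_range]
  have := Nat.ceil_lt_add_one (show (0 : ℝ) ≤ (T : ℝ) / N by positivity)
  gcongr
  linarith

variable {K N : ℕ} {ε : ℝ}

theorem le_ev_regret_of_monotone (hK : 3 ≤ K) (π : Policy K (singletons K)) (h0 : 0 ≤ ε)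
    (h1 : ε ≤ 1 / 4) {T : ℕ} {seg : ℕ → Fin N} (hmono : Monotone seg)
    (hseg : ∀ i, ((Finset.range T).filter fun s => seg s = i).card ≤ ⌈(T : ℝ) / N⌉₊)
    (hK' : 2 ≤ K) :
    ε * T / 2 - ε ^ 2 * T / ((K : ℝ) - 1) * √((K : ℝ) * T / N * Real.log (4 / 3))
      ≤ ev (bestArmLaw hK' N) fun b =>
        regret linearReward π (bumpMeans ε fun t => some (b (seg t))) T := by
  have hK3 : (3 : ℝ) ≤ K := by exact_mod_cast hK
  simp only [regret_bumpMeans π h0 h1, ev_sum, ev_const_mul, ev_sub, ev_const]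
  have hround : ∀ t ∈ Finset.range T,
      ε * (1 / 2 - 3 / 2 * ε * (√(K * Real.log (4 / 3)) / (K - 1)) * √(offset seg t))
        ≤ ε * (1 - ev (bestArmLaw hK' N) fun b =>
          playProb π (bumpMeans ε fun t => some (b (seg t))) t (b (seg t))) := by
    intro t _
    refine mul_le_mul_of_nonneg_left ?_ h0
    have := ev_bestArmLaw_le hK'
      (C := 1 / 2 + 3 / 2 * ε * (√(K * Real.log (4 / 3)) / (K - 1)) * √(offset seg t)) (seg t)
      (fun b => playProb π (bumpMeans ε fun t => some (b (seg t))) t (b (seg t)))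
      (fun b b' hb => ?_) fun b A hA => ?_
    · linarith
    · rw [hb _ le_rfl]
      -- Causality: by monotonicity of `seg`, the rounds before `t` see only segments up to that of
      -- `t`.
      refine congrFun (playProb_congr π fun s hs => ?_) _
      funext k
      simp only [bumpMeans, hb _ (hmono hs.le)]
    · simpa only [Function.update_self] using sum_playProb_update_le π hK h0 h1 seg b t A hA
  refine le_trans ?_ (Finset.sum_le_sum hround)
  rw [← Finset.mul_sum, Finset.sum_sub_distrib, ← Finset.mul_sum, Finset.sum_const,
    Finset.card_range, nsmul_eq_mul]
  have hoff := sum_sqrt_offset_le seg hseg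
  have e : √((K : ℝ) * T / N * Real.log (4 / 3))
      = √(K * Real.log (4 / 3)) * √((T : ℝ) / N) := by
    rw [← Real.sqrt_mul (by have := le_log_four_thirds; positivity)]
    congr 1
    ring
  have hc : 0 ≤ ε * (3 / 2 * ε * (√(K * Real.log (4 / 3)) / ((K : ℝ) - 1))) := by
    have : (0 : ℝ) ≤ K - 1 := by linarith
    positivity
  -- The `3 / 2` of the single-round bound cancels the `2 / 3` of the summation.
  have := mul_le_mul_of_nonneg_left hoff hc
  rw [e]
  refine le_trans (le_of_eq ?_) (sub_le_sub_left this (ε * T / 2)) |>.trans (le_of_eq ?_)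
  · ring
  · ring

theorem bumpMeans_eq_hardMeans (T : ℕ) (hN : 0 < N) (b : Fin N → Fin K) :
    (bumpMeans ε fun t => some (b (segment T N hN t))) = hardMeans T hN ε b := by
  funext t k
  simp [bumpMeans, hardMeans]

theorem segment_monotone (T : ℕ) (hN : 0 < N) : Monotone (segment T N hN) := fun s t h => by
  rw [segment, segment, Fin.mk_le_mk]
  exact min_le_min_right _ (Nat.div_le_div_right h)

theorem card_segment_le (T : ℕ) (hN : 0 < N) (i : Fin N) :
    ((Finset.range T).filter fun s => segment T N hN s = i).card ≤ ⌈(T : ℝ) / N⌉₊ := by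
  set L := ⌈(T : ℝ) / N⌉₊ with hL
  have hN' : (0 : ℝ) < N := Nat.cast_pos.2 hN
  have hTL : T ≤ L * N := by
    have := Nat.le_ceil ((T : ℝ) / N)
    rw [div_le_iff₀ hN', ← hL] at this
    exact_mod_cast this
  have hsub : ((Finset.range T).filter fun s => segment T N hN s = i)
      ⊆ Finset.Ico (L * i) (L * i + L) := by
    intro s hs
    rw [Finset.mem_filter, Finset.mem_range] at hs
    have hL0 : 0 < L := Nat.pos_of_ne_zero fun h => by simp [h] at hTL; omega
    -- The cap `N - 1` in `segment` is therefore inactive before round `T`.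
    have hlt : s / L < N := Nat.div_lt_of_lt_mul (hs.1.trans_le hTL)
    have hi : s / L = i := by
      have := congrArg Fin.val hs.2
      simp only [segment, ← hL] at this
      omega
    have := Nat.div_add_mod s L
    have := Nat.mod_lt s hL0
    rw [Finset.mem_Ico, ← hi]
    omega
  exact (Finset.card_le_card hsub).trans_eq (by simp)

theorem le_hardRegret (hK : 3 ≤ K) (hK' : 2 ≤ K) (hN : 0 < N) (π : Policy K (singletons K))
    (h0 : 0 ≤ ε) (h1 : ε ≤ 1 / 4) (T : ℕ) :
    ε * T / 2 - ε ^ 2 * T / ((K : ℝ) - 1) * √((K : ℝ) * T / N * Real.log (4 / 3))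
      ≤ hardRegret hK' hN T ε π := by
  have := le_ev_regret_of_monotone hK π h0 h1 (segment_monotone T hN) (card_segment_le T hN) hK'
  simp only [bumpMeans_eq_hardMeans] at this
  exact this

end Bound

/-! ### Balanced segments, all nonempty once `N ≤ T`. -/

section Balanced

variable {N T : ℕ}

/-- The segments of a division of `T` rounds into `N` segments whose lengths are `T / N` rounded up
or down. -/
def balancedSegment (T : ℕ) (hN : 0 < N) (t : ℕ) : Fin N := ⟨min (t * N / T) (N - 1), by omega⟩

theorem balancedSegment_monotone (T : ℕ) (hN : 0 < N) : Monotone (balancedSegment T hN) :=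
  fun s t h => by
    rw [balancedSegment, balancedSegment, Fin.mk_le_mk]
    exact min_le_min_right _ (Nat.div_le_div_right (Nat.mul_le_mul_right N h))

theorem val_balancedSegment (hN : 0 < N) {t : ℕ} (ht : t < T) :
    (balancedSegment T hN t : ℕ) = t * N / T := by
  have : t * N / T < N := Nat.div_lt_of_lt_mul (Nat.mul_lt_mul_of_pos_right ht hN)
  simp only [balancedSegment]
  omega

theorem card_balancedSegment_le (T : ℕ) (hN : 0 < N) (i : Fin N) :
    ((Finset.range T).filter fun s => balancedSegment T hN s = i).card ≤ ⌈(T : ℝ) / N⌉₊ := by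
  set A := (Finset.range T).filter fun s => balancedSegment T hN s = i with hA
  set L := ⌈(T : ℝ) / N⌉₊ with hL
  rcases A.eq_empty_or_nonempty with hA0 | hA0
  · simp [hA0]
  have hmem : ∀ s ∈ A, s < T ∧ s * N / T = i := fun s hs => by
    rw [hA, Finset.mem_filter, Finset.mem_range] at hs
    exact ⟨hs.1, by rw [← val_balancedSegment hN hs.1, hs.2]⟩
  have hsub : A ⊆ Finset.Ico (A.min' hA0) (A.min' hA0 + L) := by
    intro s hs
    refine Finset.mem_Ico.2 ⟨A.min'_le s hs, ?_⟩
    by_contra! hle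
    obtain ⟨hm, hmi⟩ := hmem _ (A.min'_mem hA0)
    obtain ⟨hsT, hsi⟩ := hmem s hs
    have hTL : T ≤ L * N := by
      have := Nat.le_ceil ((T : ℝ) / N)
      rw [div_le_iff₀ (Nat.cast_pos.2 hN), ← hL] at this
      exact_mod_cast this
    have hT : 0 < T := by omega
    -- Rounds at distance at least `L` have multiples by `N` at least `T` apart, so their quotients
    -- by `T` differ.
    have h1 : A.min' hA0 * N + T ≤ s * N := by nlinarith
    have h2 := Nat.div_le_div_right (c := T) h1
    rw [Nat.add_div_right _ hT] at h2
    omega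
  exact (Finset.card_le_card hsub).trans_eq (by simp)

/-- The means change exactly where `t * N / T` jumps; it climbs from `0` to `N - 1` in unit steps,
hence has `N - 1` jumps. -/
theorem numSegments_bumpMeans_balancedSegment {K : ℕ} {ε : ℝ} (h0 : 0 < ε) (h1 : ε ≤ 1 / 4)
    (hN : 0 < N) (hT : N ≤ T) {b : Fin N → Fin K}
    (hb : ∀ i j : Fin N, (i : ℕ) + 1 = j → b i ≠ b j) :
    numSegments (bumpMeans ε fun t => some (b (balancedSegment T hN t))) T = N := by
  have hT0 : 0 < T := hN.trans_le hT
  -- Here `N ≤ T` enters: no segment is skipped.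
  have hstep : ∀ t, (t + 1) * N / T ≤ t * N / T + 1 := fun t => by
    rw [← Nat.add_div_right _ hT0]
    exact Nat.div_le_div_right (by rw [Nat.add_mul, one_mul]; omega)
  have hmono : ∀ {s t}, s ≤ t → s * N / T ≤ t * N / T := fun h =>
    Nat.div_le_div_right (Nat.mul_le_mul_right N h)
  have hchange : ∀ t, t + 1 < T →
      (bumpMeans ε (fun t => some (b (balancedSegment T hN t))) t
          ≠ bumpMeans ε (fun t => some (b (balancedSegment T hN t))) (t + 1)
        ↔ t * N / T + 1 = (t + 1) * N / T) := by
    intro t ht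
    have e0 := val_balancedSegment hN (show t < T by omega)
    have e1 := val_balancedSegment hN ht
    constructor
    · intro hne
      by_contra hq
      refine hne ?_
      have : balancedSegment T hN t = balancedSegment T hN (t + 1) :=
        Fin.ext (by rw [e0, e1]; have := hstep t; have := hmono (show t ≤ t + 1 by omega); omega)
      funext k
      simp only [bumpMeans, this]
    · intro hq heq
      have hbne := hb (balancedSegment T hN t) (balancedSegment T hN (t + 1)) (by rw [e0, e1, hq])
      have := congrArg (fun p : I => (p : ℝ)) (congrFun heq (b (balancedSegment T hN t)))
      simp only [coe_bumpMeans h0.le h1, if_true, Option.some.injEq, hbne, if_false] at this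
      linarith
  have hcard : Set.ncard {t : ℕ | t + 1 < T ∧
      bumpMeans ε (fun t => some (b (balancedSegment T hN t))) t
        ≠ bumpMeans ε (fun t => some (b (balancedSegment T hN t))) (t + 1)}
      = Set.ncard (Finset.range (N - 1) : Set ℕ) := by
    refine Set.ncard_congr (fun t _ => t * N / T) ?_ ?_ ?_
    · rintro t ⟨ht, hne⟩
      rw [hchange t ht] at hne
      have : (t + 1) * N / T < N := Nat.div_lt_of_lt_mul (Nat.mul_lt_mul_of_pos_right ht hN)
      rw [Finset.mem_coe, Finset.mem_range]
      omega
    · rintro s t ⟨hs, hsne⟩ ⟨ht, htne⟩ hst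
      rw [hchange s hs] at hsne
      rw [hchange t ht] at htne
      rcases lt_trichotomy s t with h | h | h
      · have := hmono (show s + 1 ≤ t from h)
        omega
      · exact h
      · have := hmono (show t + 1 ≤ s from h)
        omega
    · intro j hj
      rw [Finset.mem_coe, Finset.mem_range] at hj
      -- The last round with `t * N < (j + 1) * T`, that is, the last one in segment `j`.
      set t := ((j + 1) * T - 1) / N with ht
      have hpos : 0 < (j + 1) * T := by positivity
      have hlow : t * N / T < j + 1 := by
        rw [Nat.div_lt_iff_lt_mul hT0]
        have := Nat.div_mul_le_self ((j + 1) * T - 1) N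
        rw [← ht] at this
        omega
      have hupp : j + 1 ≤ (t + 1) * N / T := by
        rw [Nat.le_div_iff_mul_le hT0]
        have := Nat.lt_div_mul_add hN (a := (j + 1) * T - 1)
        rw [← ht] at this
        rw [Nat.add_mul t, one_mul]
        omega
      have := hstep t
      -- Otherwise the quotient at `t` would be at least its value at `T - 1`, which is at least `N
      -- - 1 > j`.
      have htT : t + 1 < T := by
        by_contra! hle
        have h1 := hmono (show T - 1 ≤ t by omega)
        have h2 := hstep (T - 1)
        rw [Nat.sub_add_cancel hT0, Nat.mul_div_cancel_left N hT0] at h2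
        omega
      exact ⟨t, ⟨htT, (hchange t htT).2 (by omega)⟩, by omega⟩
  rw [numSegments, hcard, Set.ncard_coe_finset, Finset.card_range]
  omega

end Balanced

/-- With `s = √(K T log(4/3) / N)`, the quadratic in `ε` is maximal at `ε = (K - 1) / (4 s)`, with
value `(K - 1) T / (16 s)`; the constant `24` comes from `K - 1 ≥ 2 K / 3`. The condition on `T`
says `s ≥ K - 1`, that is, `ε ≤ 1 / 4`. -/
theorem tuned_gap_bounds {K N T : ℕ} (hK : 3 ≤ K) (hN : 0 < N)
    (hT : (N : ℝ) * ((K : ℝ) - 1) ^ 2 / (K * Real.log (4 / 3)) ≤ T) {ε : ℝ}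
    (hε : ε = ((K : ℝ) - 1) / 4 * √((N : ℝ) / (T * K * Real.log (4 / 3)))) :
    N ≤ T ∧ 0 < ε ∧ ε ≤ 1 / 4 ∧ 1 / (24 * √(Real.log (4 / 3))) * √((N : ℝ) * K * T)
      ≤ ε * T / 2 - ε ^ 2 * T / ((K : ℝ) - 1) * √((K : ℝ) * T / N * Real.log (4 / 3)) := by
  have hK' : (3 : ℝ) ≤ K := by exact_mod_cast hK
  have hN' : (1 : ℝ) ≤ N := by exact_mod_cast hN
  have hl := le_log_four_thirds
  have hl3 := log_four_thirds_le
  set l := Real.log (4 / 3) with hldef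
  have hKl : 0 < K * l := by positivity
  rw [div_le_iff₀ hKl] at hT
  have hNT : (N : ℝ) ≤ T := by
    have h1 : K * l ≤ ((K : ℝ) - 1) ^ 2 := by nlinarith
    have h2 : (N : ℝ) * (K * l) ≤ T * (K * l) := by nlinarith
    exact le_of_mul_le_mul_right h2 hKl
  have hT0 : (0 : ℝ) < T := by linarith
  set s := √((K : ℝ) * T / N * l) with hs
  have hs2 : s ^ 2 = (K : ℝ) * T / N * l := Real.sq_sqrt (by positivity)
  have hs0 : 0 < s := Real.sqrt_pos.2 (by positivity)
  have hεs : ε = (K - 1) / (4 * s) := by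
    rw [hε, show (N : ℝ) / (T * K * l) = ((K : ℝ) * T / N * l)⁻¹ by field_simp, Real.sqrt_inv,
      ← hs]
    field_simp
  have hsK : (K : ℝ) - 1 ≤ s := by
    refine Real.le_sqrt_of_sq_le ?_
    rw [div_mul_eq_mul_div, le_div_iff₀ (by linarith)]
    linarith
  refine ⟨by exact_mod_cast hNT, ?_, ?_, ?_⟩
  · rw [hεs]
    exact div_pos (by linarith) (by linarith)
  · rw [hεs, div_le_iff₀ (by linarith)]
    linarith
  · have hK1 : (K : ℝ) - 1 ≠ 0 := by linarith
    have e1 : ε * T / 2 - ε ^ 2 * T / ((K : ℝ) - 1) * s = (K - 1) * T / (16 * s) := by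
      rw [hεs]
      field_simp
      ring
    have e2 : 1 / (24 * √l) * √((N : ℝ) * K * T) = K * T / (24 * s) := by
      have hmul : √((N : ℝ) * K * T) * s = K * T * √l := by
        rw [hs, ← Real.sqrt_mul (by positivity), show (N : ℝ) * K * T * (K * T / N * l)
          = (K * T) ^ 2 * l by field_simp, Real.sqrt_mul (by positivity),
          Real.sqrt_sq (by positivity)]
      have : 0 < √l := Real.sqrt_pos.2 (by linarith)
      field_simp
      linarith
    rw [e1, e2, div_le_div_iff₀ (by linarith) (by linarith)]
    nlinarith [mul_pos hT0 hs0]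

end SemiBandit

end

theorem mainTheorem3 (K N T : ℕ) (hK : 3 ≤ K) (hN : 0 < N)
    (π : SemiBandit.Policy K (SemiBandit.singletons K)) :
    (∀ ε : ℝ, 0 < ε → ε ≤ 1 / 4 →
      ε * T / 2 - ε ^ 2 * T / ((K : ℝ) - 1) * √((K : ℝ) * T / N * Real.log (4 / 3))
        ≤ SemiBandit.hardRegret (le_trans (by norm_num) hK) hN T ε π) ∧
    ((N : ℝ) * ((K : ℝ) - 1) ^ 2 / (K * Real.log (4 / 3)) ≤ T →
      1 / (24 * √(Real.log (4 / 3))) * √((N : ℝ) * K * T)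
        ≤ SemiBandit.hardRegret (le_trans (by norm_num) hK) hN T
            (((K : ℝ) - 1) / 4 * √((N : ℝ) / (T * K * Real.log (4 / 3)))) π ∧
      ∃ μ : ℕ → Fin K → unitInterval,
        SemiBandit.numSegments μ T = N ∧
        1 / (24 * √(Real.log (4 / 3))) * √((N : ℝ) * K * T)
          ≤ SemiBandit.regret SemiBandit.linearReward π μ T) := by
  have hK2 : 2 ≤ K := le_trans (by norm_num) hK
  refine ⟨fun ε h0 h1 => SemiBandit.le_hardRegret hK hK2 hN π h0.le h1 T, fun hT => ?_⟩
  obtain ⟨hNT, h0, h1, hle⟩ := SemiBandit.tuned_gap_bounds hK hN hT rfl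
  refine ⟨hle.trans (SemiBandit.le_hardRegret hK hK2 hN π h0.le h1 T), ?_⟩
  obtain ⟨b, hb, hreg⟩ := SemiBandit.exists_pos_and_le_of_le_ev _
    (hle.trans (SemiBandit.le_ev_regret_of_monotone hK π h0.le h1
      (SemiBandit.balancedSegment_monotone T hN) (SemiBandit.card_balancedSegment_le T hN) hK2))
  exact ⟨_, SemiBandit.numSegments_bumpMeans_balancedSegment h0 h1 hN hNT fun i j hij =>
    SemiBandit.ne_of_bestArmLaw_ne_zero hK2 hb hij, hreg⟩
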